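/- For points of $\mathbb Z^2$, write $p\leftrightarrow_{c_2}q$ if $p\neq q$ and both coordinates differ by at most $1$, and $p\leftrightarrow_{c_1}q$ if in addition $p$ and $q$ differ in only one coordinate. A set $X\subset\mathbb Z^2$ with $c_2$-adjacency is regarded as a graph; a map $f:X\to X$ is $c_2$-continuous if it maps $c_2$-connected sets to $c_2$-connected sets, and $d_{c_2}$ is the path-length metric of $X$. If $X$ is $c_2$-connected, a set $A\subset X$ is a cold set for $(X,c_2)$ if every $c_2$-continuous $f:X\to X$ with $f|_A=\mathrm{id}_A$ satisfies $d_{c_2}(x,f(x))\le 1$ for all $x\in X$; it is minimal if no proper subset of $A$ is a cold set for $(X,c_2)$. A $c_2$-closed curve is a cyclic sequence $S=(s_i)_{i\in\mathbb Z/m}$, $m\ge 1$, of pairwise distinct points of $\mathbb Z^2$ whose consecutive members are $c_2$-adjacent or equal. If $\mathbb Z^2\setminus S$ has exactly two $c_1$-components, one finite (denoted $\mathrm{Int}(S)$) and one infinite, then $X=S\cup \mathrm{Int}(S)$ is a digital disk and $S$ is a bounding curve of $X$. A side (edge) of $S$ is a maximal digital line segment of $S$, that is, a maximal set of at least two consecutive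 points of $S$ that are collinear; its endpoints are its first and last points. A side is slanted if it has slope $\pm1$. The interior angle of $S$ at a common endpoint of two sides is the angle between these sides on the side of $\mathrm{Int}(S)$. A digital disk $X$ is thick if it has a bounding curve $S$ such that: (i) for every point $p$ of a slanted side of $S$ other than its endpoints there is $c\in X$ with $c\leftrightarrow_{c_2}p$ and $c\not\leftrightarrow_{c_1}p$; (ii) for every vertex $p$ of an interior angle of $90^\circ$ of $S$ there is $q\in \mathrm{Int}(S)$ such that $q\leftrightarrow_{c_1}p$ if the sides of the angle are slanted, and $q\leftrightarrow_{c_2}p$, $q\not\leftrightarrow_{c_1}p$ if they are axis-parallel; (iii) for every vertex $p$ of an interior angle of $135^\circ$ of $S$ there are $b,b'\in X$ in the interior of the angle with $b\leftrightarrow_{c_2}p$, $b\not\leftrightarrow_{c_1}p$ and $b'\leftrightarrow_{c_1}p$. Proposition. Let $X\subset\mathbb Z^2$ be a thick digital disk, and let $S$ be a bounding curve of $X$ that has exactly four sides, all of which are slanted. Let $A$ be the set of endpoints of the sides of $S$. Then $A$ is a minimal cold set for $(X,c_2)$. -/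

import Mathlib

namespace DigitalPlane

/-- `c₁`-adjacency (4-adjacency) on `ℤ²`: distinct points whose coordinates differ by at most `1`,
and which differ in at most one coordinate. -/
def c1 : SimpleGraph (ℤ × ℤ) where
  Adj p q := p ≠ q ∧ |p.1 - q.1| ≤ 1 ∧ |p.2 - q.2| ≤ 1 ∧ (p.1 = q.1 ∨ p.2 = q.2)
  symm := ⟨fun p q ⟨h, h1, h2, h3⟩ =>
    ⟨h.symm, by rwa [abs_sub_comm], by rwa [abs_sub_comm], h3.imp Eq.symm Eq.symm⟩⟩
  loopless := ⟨fun _ h => h.1 rfl⟩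

/-- `c₂`-adjacency (8-adjacency) on `ℤ²`: distinct points whose coordinates differ by at most
`1`. -/
def c2 : SimpleGraph (ℤ × ℤ) where
  Adj p q := p ≠ q ∧ |p.1 - q.1| ≤ 1 ∧ |p.2 - q.2| ≤ 1
  symm := ⟨fun p q ⟨h, h1, h2⟩ => ⟨h.symm, by rwa [abs_sub_comm], by rwa [abs_sub_comm]⟩⟩
  loopless := ⟨fun _ h => h.1 rfl⟩

/-! ### Continuous self-maps and cold sets -/

/-- A self-map of a digital image (a graph) is continuous if it maps connected sets to connected
sets. -/
def IsContinuous {V : Type*} (G : SimpleGraph V) (f : V → V) : Prop :=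
  ∀ Y : Set V, (G.induce Y).Preconnected → (G.induce (f '' Y)).Preconnected

/-- `A` is an `s`-cold set for the connected digital image `(X, κ)`; the distance is the
path-length metric of `(X, κ)`. -/
def IsSColdSet (κ : SimpleGraph (ℤ × ℤ)) (X : Set (ℤ × ℤ)) (s : ℕ) (A : Set (ℤ × ℤ)) : Prop :=
  (κ.induce X).Connected ∧ A ⊆ X ∧
    ∀ f : X → X, IsContinuous (κ.induce X) f → (∀ x : X, (x : ℤ × ℤ) ∈ A → f x = x) →
      ∀ x : X, (κ.induce X).dist x (f x) ≤ s

/-- A cold set is a `1`-cold set. -/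
def IsColdSet (κ : SimpleGraph (ℤ × ℤ)) (X A : Set (ℤ × ℤ)) : Prop :=
  IsSColdSet κ X 1 A

/-- A cold set no proper subset of which is a cold set. -/
def IsMinimalColdSet (κ : SimpleGraph (ℤ × ℤ)) (X A : Set (ℤ × ℤ)) : Prop :=
  IsColdSet κ X A ∧ ∀ B : Set (ℤ × ℤ), B ⊂ A → ¬ IsColdSet κ X B

/-! ### Digital line segments -/

/-- The points of `σ` lie on one line. -/
def IsCollinear (σ : Set (ℤ × ℤ)) : Prop :=
  ∀ p ∈ σ, ∀ q ∈ σ, ∀ r ∈ σ,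
    (q.1 - p.1) * (r.2 - p.2) = (r.1 - p.1) * (q.2 - p.2)

/-- A digital line segment: a finite connected set of at least two collinear points
(a `c₁`-connected set is also `c₂`-connected). -/
def IsDigitalSegment (σ : Set (ℤ × ℤ)) : Prop :=
  σ.Finite ∧ σ.Nontrivial ∧ (c2.induce σ).Preconnected ∧ IsCollinear σ

/-- All points of `σ` lie on a line of slope `1` or `-1`. -/
def IsSlanted (σ : Set (ℤ × ℤ)) : Prop :=
  (∀ p ∈ σ, ∀ q ∈ σ, p.1 - q.1 = p.2 - q.2) ∨ (∀ p ∈ σ, ∀ q ∈ σ, p.1 - q.1 = -(p.2 - q.2))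

/-! ### Closed curves and disks -/

/-- A digital `c₂`-closed curve: a cyclic sequence of pairwise distinct points
in which consecutive points are adjacent or equal. -/
structure ClosedCurve where
  m : ℕ
  [pos : NeZero m]
  pt : ZMod m → ℤ × ℤ
  inj : Function.Injective pt
  adj : ∀ i, pt i = pt (i + 1) ∨ c2.Adj (pt i) (pt (i + 1))

attribute [instance] ClosedCurve.pos

namespace ClosedCurve

variable (S : ClosedCurve)

/-- The set of points of the curve. -/
def carrier : Set (ℤ × ℤ) := Set.range S.pt

/-- The complement of the curve, with `c₁`-adjacency. -/
abbrev complGraph : SimpleGraph (S.carrierᶜ : Set (ℤ × ℤ)) := c1.induce S.carrierᶜ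

/-- The complement of the curve has exactly two `c₁`-components, one finite, one infinite. -/
def Separates : Prop :=
  ∃ C D : S.complGraph.ConnectedComponent,
    C.supp.Finite ∧ D.supp.Infinite ∧ ∀ E : S.complGraph.ConnectedComponent, E = C ∨ E = D

/-- `Int(S)`: the points off the curve whose `c₁`-component in the complement is finite. -/
def interior : Set (ℤ × ℤ) :=
  {p | ∃ h : p ∈ S.carrierᶜ, (S.complGraph.connectedComponentMk ⟨p, h⟩).supp.Finite}

/-- `S` is a bounding curve of the digital disk `X`. -/
def Bounds (X : Set (ℤ × ℤ)) : Prop :=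
  S.Separates ∧ X = S.carrier ∪ S.interior

/-- The points `s i, s (i + 1), …, s (i + k)` of the curve. -/
def arc (i : ZMod S.m) (k : ℕ) : Set (ℤ × ℤ) :=
  {p | ∃ j : ℕ, j ≤ k ∧ p = S.pt (i + j)}

/-- The arc of `k + 1` distinct points from `s i` to `s (i + k)` is a digital line segment. -/
def IsSegmentArc (i : ZMod S.m) (k : ℕ) : Prop :=
  1 ≤ k ∧ k < S.m ∧ IsDigitalSegment (S.arc i k)

/-- The arc from `s i` to `s (i + k)` is a side (edge) of the curve: a maximal digital line segment
in the curve. -/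
def IsSideArc (i : ZMod S.m) (k : ℕ) : Prop :=
  S.IsSegmentArc i k ∧
    ∀ i' k', S.IsSegmentArc i' k' → S.arc i k ⊆ S.arc i' k' → S.arc i' k' = S.arc i k

/-- The set of sides of the curve. -/
def sides : Set (Set (ℤ × ℤ)) :=
  {σ | ∃ i k, S.IsSideArc i k ∧ σ = S.arc i k}

/-- The set of endpoints of the sides of the curve. -/
def sideEndpoints : Set (ℤ × ℤ) :=
  {p | ∃ i k, S.IsSideArc i k ∧ (p = S.pt i ∨ p = S.pt (i + k))}

/-! ### Interior angles -/

/-- The winding number of the closed polygon `s 0, s 1, …` around a lattice point `q` off the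
curve: the number of edges that cross upwards, minus the number of edges that cross downwards, a ray
from `q` to the right that is tilted upwards infinitesimally. -/
def winding (q : ℤ × ℤ) : ℤ :=
  ∑ i : ZMod S.m,
    ((if (S.pt i).2 = q.2 ∧ (S.pt (i + 1)).2 = q.2 + 1 ∧ q.1 < (S.pt i).1 then 1 else 0) -
     (if (S.pt i).2 = q.2 + 1 ∧ (S.pt (i + 1)).2 = q.2 ∧ q.1 < (S.pt (i + 1)).1 then 1 else 0))

/-- The curve runs counterclockwise around its interior. -/
def IsCounterclockwise : Prop := ∀ q ∈ S.interior, 0 < S.winding q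

/-- The curve runs clockwise around its interior. -/
def IsClockwise : Prop := ∀ q ∈ S.interior, S.winding q < 0

end ClosedCurve

/-- The eight unit directions in counterclockwise order; `compass (u + 1)` is `compass u`
turned by `45°`. -/
def compass : ZMod 8 → ℤ × ℤ :=
  ![(1, 0), (1, 1), (0, 1), (-1, 1), (-1, 0), (-1, -1), (0, -1), (1, -1)]

/-- The direction `compass u` is slanted. -/
def IsSlantedDir (u : ZMod 8) : Prop :=
  (compass u).1 ≠ 0 ∧ (compass u).2 ≠ 0

namespace ClosedCurve

variable (S : ClosedCurve)

/-- The interior angle of the curve at the vertex `s i` is the sector that starts at the direction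
`compass u` and extends counterclockwise by `t * 45°`. Its two sides point to the neighbours of
`s i` on the curve, and it lies on the side of `Int(S)`: to the left of the curve if the curve runs
counterclockwise, to the right if it runs clockwise. -/
def IsInteriorAngle (i : ZMod S.m) (u : ZMod 8) (t : ℕ) : Prop :=
  0 < t ∧ t < 8 ∧
    ((S.IsCounterclockwise ∧
        S.pt (i + 1) = S.pt i + compass u ∧ S.pt (i - 1) = S.pt i + compass (u + t)) ∨
     (S.IsClockwise ∧
        S.pt (i - 1) = S.pt i + compass u ∧ S.pt (i + 1) = S.pt i + compass (u + t)))

/-! ### Thickness -/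

/-- `X` is slant-thick at `p`. -/
def SlantThickAt (X : Set (ℤ × ℤ)) (p : ℤ × ℤ) : Prop :=
  ∃ c ∈ X, c2.Adj c p ∧ ¬ c1.Adj p c

/-- The disk bounded by `S` is `90°`-thick at the vertex `p` of a `90°` interior angle that starts
at the direction `compass u`. (Both sides of the angle are slanted, or both are axis-parallel.) -/
def NinetyThickAt (p : ℤ × ℤ) (u : ZMod 8) : Prop :=
  ∃ q ∈ S.interior,
    (¬ IsSlantedDir u → c2.Adj q p ∧ ¬ c1.Adj p q) ∧ (IsSlantedDir u → c1.Adj q p)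

/-- `X` is `135°`-thick at the vertex `p` of a `135°` interior angle that starts at the direction
`compass u`. The points `p + compass (u + r)` with `0 < r < 3` are the `c₂`-neighbours of `p` in
the interior of the angle. -/
def OneThirtyFiveThickAt (X : Set (ℤ × ℤ)) (p : ℤ × ℤ) (u : ZMod 8) : Prop :=
  ∃ b ∈ X, ∃ b' ∈ X,
    (∃ r : ℕ, 0 < r ∧ r < 3 ∧ b = p + compass (u + r)) ∧
    (∃ r : ℕ, 0 < r ∧ r < 3 ∧ b' = p + compass (u + r)) ∧
    (c2.Adj b p ∧ ¬ c1.Adj p b) ∧ c1.Adj b' p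

end ClosedCurve

/-- `X` is a thick digital disk. -/
def IsThickDisk (X : Set (ℤ × ℤ)) : Prop :=
  ∃ S : ClosedCurve, S.Bounds X ∧
    (∀ i k, S.IsSideArc i k → IsSlanted (S.arc i k) →
      ∀ p ∈ S.arc i k, p ≠ S.pt i → p ≠ S.pt (i + k) → ClosedCurve.SlantThickAt X p) ∧
    (∀ i u, S.IsInteriorAngle i u 2 → S.NinetyThickAt (S.pt i) u) ∧
    (∀ i u, S.IsInteriorAngle i u 3 → ClosedCurve.OneThirtyFiveThickAt X (S.pt i) u)

end DigitalPlane

/-!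
A curve all of whose sides are slanted moves diagonally at every step and turns by a right angle, so
if it has four sides, then the opposite ones cancel and it is the boundary of a slanted rectangle;
the disk is then the whole rectangle.

Along a walk of length `n` a coordinate changes by at most `n`, also after applying a continuous
map. So a continuous map that fixes both ends of a row, column or diagonal preserves the
corresponding coordinates on it. Hence a map that fixes the four corners fixes the four sides, and
then, by rows and columns, every point. Conversely, every cold set contains every corner `p`: the
point `q` two units from `p` towards the inside of the rectangle is adjacent or equal to every
neighbour of `p`, so that `p` can be folded onto `q` while everything else stays fixed.
-/

namespace DigitalPlane

/-! ### Diagonal steps of the lattice -/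

/-- A diagonal unit step of the lattice: one of the four slanted compass directions. -/
def IsDiagonalStep (v : ℤ × ℤ) : Prop := (v.1 = 1 ∨ v.1 = -1) ∧ (v.2 = 1 ∨ v.2 = -1)

/-- Orthogonality of lattice vectors for the standard inner product. -/
def IsOrthogonal (v w : ℤ × ℤ) : Prop := v.1 * w.1 + v.2 * w.2 = 0

/-- The lattice points `p, p + v, …, p + n • v` in arithmetic progression. -/
def latticeSegment (p v : ℤ × ℤ) (n : ℕ) : Set (ℤ × ℤ) := {q | ∃ j : ℕ, j ≤ n ∧ q = p + (j : ℤ) • v}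

theorem isCollinear_latticeSegment (p v : ℤ × ℤ) (n : ℕ) : IsCollinear (latticeSegment p v n) := by
  rintro _ ⟨j, -, rfl⟩ _ ⟨k, -, rfl⟩ _ ⟨l, -, rfl⟩
  simp only [Prod.fst_add, Prod.snd_add, Prod.smul_fst, Prod.smul_snd, smul_eq_mul]
  ring

theorem latticeSegment_reverse (p v : ℤ × ℤ) (n : ℕ) :
    latticeSegment (p + (n : ℤ) • v) (-v) n = latticeSegment p v n := by
  ext q
  constructor <;> rintro ⟨j, hj, rfl⟩ <;> refine ⟨n - j, Nat.sub_le n j, ?_⟩ <;>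
    rw [Nat.cast_sub hj] <;> module

namespace IsDiagonalStep

variable {v w : ℤ × ℤ}

theorem isOrthogonal (hv : IsDiagonalStep v) (hw : IsDiagonalStep w) (hne : w ≠ v)
    (hneg : w ≠ -v) : IsOrthogonal v w := by
  simp only [ne_eq, Prod.ext_iff, Prod.fst_neg, Prod.snd_neg] at hne hneg
  unfold IsOrthogonal
  obtain ⟨hv₁ | hv₁, hv₂ | hv₂⟩ := hv <;> rw [hv₁, hv₂] at hne hneg ⊢ <;>
    obtain ⟨hw₁ | hw₁, hw₂ | hw₂⟩ := hw <;> omega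

theorem zsmul_add_zsmul_eq_zero (hv : IsDiagonalStep v) (hw : IsDiagonalStep w)
    (h : IsOrthogonal v w) {x y : ℤ} (h0 : x • v + y • w = 0) : x = 0 ∧ y = 0 := by
  simp only [Prod.ext_iff, Prod.fst_add, Prod.snd_add, Prod.smul_fst, Prod.smul_snd,
    smul_eq_mul, Prod.fst_zero, Prod.snd_zero] at h0
  unfold IsOrthogonal at h
  obtain ⟨hv₁ | hv₁, hv₂ | hv₂⟩ := hv <;> obtain ⟨hw₁ | hw₁, hw₂ | hw₂⟩ := hw <;>
    simp only [hv₁, hv₂, hw₁, hw₂] at h h0 <;> omega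

theorem zsmul_eq_zero (hv : IsDiagonalStep v) {x : ℤ} (h0 : x • v = 0) : x = 0 := by
  have h := congrArg Prod.fst h0
  rcases hv.1 with hv₁ | hv₁ <;> simpa [hv₁] using h

theorem eq_or_eq_neg {u : ℤ × ℤ} (hu : IsDiagonalStep u) (hv : IsDiagonalStep v)
    (hw : IsDiagonalStep w) (huv : IsOrthogonal u v) (hvw : IsOrthogonal v w) :
    w = u ∨ w = -u := by
  by_contra! hne
  have huw := hu.isOrthogonal hw hne.1 hne.2
  unfold IsOrthogonal at huv hvw huw
  obtain ⟨hu₁ | hu₁, hu₂ | hu₂⟩ := hu <;> obtain ⟨hv₁ | hv₁, hv₂ | hv₂⟩ := hv <;>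
    simp only [hu₁, hu₂, hv₁, hv₂] at huv hvw huw <;> obtain ⟨hw₁ | hw₁, -⟩ := hw <;> omega

theorem zsmul_add_zsmul_add_zsmul_ne_zero {e f g : ℤ × ℤ} (he : IsDiagonalStep e)
    (hf : IsDiagonalStep f) (hg : IsDiagonalStep g) (hef : IsOrthogonal e f)
    (hfg : IsOrthogonal f g) {a b c : ℤ} (hb : b ≠ 0) : a • e + b • f + c • g ≠ 0 := by
  intro h0
  rcases he.eq_or_eq_neg hf hg hef hfg with rfl | rfl
  · exact hb (he.zsmul_add_zsmul_eq_zero hf hef (x := a + c) (by rw [← h0]; module)).2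
  · exact hb (he.zsmul_add_zsmul_eq_zero hf hef (x := a - c) (by rw [← h0]; module)).2

theorem rectangle_of_closed {e f g h : ℤ × ℤ} (he : IsDiagonalStep e) (hf : IsDiagonalStep f)
    (hg : IsDiagonalStep g) (hh : IsDiagonalStep h) (hef : IsOrthogonal e f)
    (hfg : IsOrthogonal f g) (hgh : IsOrthogonal g h) {a b c d : ℤ} (ha : 0 < a) (hb : 0 < b)
    (hc : 0 < c) (hd : 0 < d) (h0 : a • e + b • f + c • g + d • h = 0) :
    g = -e ∧ h = -f ∧ c = a ∧ d = b := by
  have key : ∀ x y : ℤ, x • e + y • f = 0 → x = 0 ∧ y = 0 := fun x y =>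
    he.zsmul_add_zsmul_eq_zero hf hef
  rcases he.eq_or_eq_neg hf hg hef hfg with rfl | rfl <;>
    rcases hf.eq_or_eq_neg hg hh hfg hgh with rfl | rfl
  · have := key (a + c) (b + d) (by rw [← h0]; module)
    omega
  · have := key (a + c) (b - d) (by rw [← h0]; module)
    omega
  · have := key (a - c) (b + d) (by rw [← h0]; module)
    omega
  · have := key (a - c) (b - d) (by rw [← h0]; module)
    exact ⟨rfl, rfl, by omega, by omega⟩

end IsDiagonalStep

theorem eq_of_natCast_zmod_eq {m a b : ℕ} (ha : a < m) (hb : b < m) (h : (a : ZMod m) = b) :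
    a = b :=
  CharP.natCast_injOn_Iio (ZMod m) m ha hb h

theorem reachable_of_eq_or_adj {V : Type*} {G : SimpleGraph V} {x y : V}
    (h : x = y ∨ G.Adj x y) : G.Reachable x y :=
  h.elim (fun h => h ▸ SimpleGraph.Reachable.rfl) SimpleGraph.Adj.reachable

namespace ClosedCurve

variable {S : ClosedCurve}

/-! ### Segments and sides of a closed curve -/

theorem arc_subset_carrier (i : ZMod S.m) (k : ℕ) : S.arc i k ⊆ S.carrier := by
  rintro p ⟨j, -, rfl⟩
  exact Set.mem_range_self _

theorem pt_mem_arc (i : ZMod S.m) {k j : ℕ} (h : j ≤ k) : S.pt (i + j) ∈ S.arc i k :=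
  ⟨j, h, rfl⟩

theorem pt_mem_arc_self (i : ZMod S.m) (k : ℕ) : S.pt i ∈ S.arc i k :=
  ⟨0, Nat.zero_le k, by simp⟩

theorem pt_add_one_mem_arc (i : ZMod S.m) {k : ℕ} (hk : 1 ≤ k) : S.pt (i + 1) ∈ S.arc i k :=
  ⟨1, hk, by simp⟩

theorem arc_preconnected (i : ZMod S.m) (k : ℕ) : (c2.induce (S.arc i k)).Preconnected := by
  have reachable_start : ∀ j (hj : j ≤ k), (c2.induce (S.arc i k)).Reachable
      ⟨S.pt i, pt_mem_arc_self i k⟩ ⟨S.pt (i + j), pt_mem_arc i hj⟩ := by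
    intro j hj
    induction j with
    | zero => exact reachable_of_eq_or_adj (Or.inl (by simp))
    | succ j ih =>
      have hnext : i + (j + 1 : ℕ) = i + j + 1 := by push_cast; ring
      refine (ih (by omega)).trans (reachable_of_eq_or_adj ?_)
      simp only [Subtype.mk.injEq, SimpleGraph.comap_adj, Function.Embedding.subtype_apply, hnext]
      exact S.adj (i + j)
  rintro ⟨_, j, hj, rfl⟩ ⟨_, l, hl, rfl⟩
  exact (reachable_start j hj).symm.trans (reachable_start l hl)

theorem isSegmentArc_of_isCollinear {i : ZMod S.m} {k : ℕ} (hk : 1 ≤ k) (hkm : k < S.m)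
    (hc : IsCollinear (S.arc i k)) : S.IsSegmentArc i k := by
  refine ⟨hk, hkm, (Set.finite_range S.pt).subset (arc_subset_carrier i k), ?_,
    arc_preconnected i k, hc⟩
  refine ⟨_, pt_mem_arc i (Nat.zero_le k), _, pt_mem_arc i hk, fun h => ?_⟩
  exact zero_ne_one (eq_of_natCast_zmod_eq (by omega) (by omega) (add_left_cancel (S.inj h)))

theorem isSegmentArc_one (hm : 2 ≤ S.m) (i : ZMod S.m) : S.IsSegmentArc i 1 := by
  refine isSegmentArc_of_isCollinear le_rfl hm ?_
  rintro _ ⟨j, hj, rfl⟩ _ ⟨k, hk, rfl⟩ _ ⟨l, hl, rfl⟩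
  interval_cases j <;> interval_cases k <;> interval_cases l <;> ring

theorem IsSegmentArc.exists_isSideArc {i : ZMod S.m} {k : ℕ} (h : S.IsSegmentArc i k) :
    ∃ i' k', S.IsSideArc i' k' ∧ S.arc i k ⊆ S.arc i' k' := by
  let segments : Set (Set (ℤ × ℤ)) := {σ | ∃ i' k', S.IsSegmentArc i' k' ∧ σ = S.arc i' k'}
  have hfin : segments.Finite := by
    refine (Set.finite_range S.pt).powerset.subset ?_
    rintro _ ⟨i', k', -, rfl⟩
    exact arc_subset_carrier i' k'
  obtain ⟨_, hle, hmax⟩ := hfin.exists_le_maximal (a := S.arc i k) ⟨i, k, h, rfl⟩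
  obtain ⟨i', k', h', rfl⟩ := hmax.prop
  exact ⟨i', k', ⟨h', fun i'' k'' h'' hs => (hmax.eq_of_le ⟨i'', k'', h'', rfl⟩ hs).symm⟩, hle⟩

theorem three_le_m (h : 1 < S.sides.ncard) : 3 ≤ S.m := by
  by_contra! hlt
  have hsub : S.sides ⊆ {S.carrier} := by
    rintro _ ⟨i, k, ⟨⟨hk, -⟩, -⟩, rfl⟩
    refine (arc_subset_carrier i k).antisymm ?_
    rintro _ ⟨z, rfl⟩
    have hz := ZMod.val_lt (z - i)
    exact ⟨(z - i).val, by omega, by simp⟩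
  have := Set.ncard_le_ncard hsub
  rw [Set.ncard_singleton] at this
  omega

/-! ### Turns and sides of a diagonal curve -/

/-- The displacement from `s i` to `s (i + 1)`. -/
def step (S : ClosedCurve) (i : ZMod S.m) : ℤ × ℤ := S.pt (i + 1) - S.pt i

/-- The curve is diagonal: it moves along a diagonal of the lattice at every step. -/
def IsDiagonal (S : ClosedCurve) : Prop := ∀ i, IsDiagonalStep (S.step i)

/-- The indices at which the curve changes its direction. -/
def turns (S : ClosedCurve) : Set (ZMod S.m) := {i | S.step i ≠ S.step (i - 1)}

/-- The number of steps from `s i` to the first turn after it (`0` if the curve has no turn). -/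
noncomputable def runLength (S : ClosedCurve) (i : ZMod S.m) : ℕ :=
  sInf {k | 1 ≤ k ∧ i + k ∈ S.turns}

/-- The first turn after `s i`. -/
noncomputable def nextTurn (S : ClosedCurve) (i : ZMod S.m) : ZMod S.m := i + S.runLength i

theorem pt_add_one (i : ZMod S.m) : S.pt (i + 1) = S.pt i + S.step i :=
  (add_sub_cancel _ _).symm

theorem isDiagonal_of_isSlanted (hm : 2 ≤ S.m) (hslanted : ∀ σ ∈ S.sides, IsSlanted σ) :
    S.IsDiagonal := by
  intro i
  obtain ⟨i', k', hside, hsub⟩ := (isSegmentArc_one hm i).exists_isSideArc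
  have h0 := hsub (pt_mem_arc_self i 1)
  have h1 := hsub (pt_add_one_mem_arc i le_rfl)
  have hne : S.pt i ≠ S.pt (i + 1) := fun h => zero_ne_one <|
    eq_of_natCast_zmod_eq (m := S.m) (by omega) hm (by simpa [eq_comm] using S.inj h)
  obtain ⟨-, hx, hy⟩ := (S.adj i).resolve_left hne
  rw [abs_le] at hx hy
  rw [Ne, Prod.ext_iff] at hne
  simp only [IsDiagonalStep, step, Prod.fst_sub, Prod.snd_sub]
  rcases hslanted _ ⟨i', k', hside, rfl⟩ with h | h <;>
  · have := h _ h0 _ h1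
    omega

theorem pt_sub_one_ne_pt_add_one (hm : 3 ≤ S.m) (i : ZMod S.m) :
    S.pt (i - 1) ≠ S.pt (i + 1) := by
  intro h
  refine two_ne_zero (eq_of_natCast_zmod_eq (m := S.m) (by omega) (by omega) ?_)
  push_cast
  linear_combination -S.inj h

theorem IsDiagonal.isOrthogonal_step (hd : S.IsDiagonal) (hm : 3 ≤ S.m) {i : ZMod S.m}
    (hi : i ∈ S.turns) : IsOrthogonal (S.step (i - 1)) (S.step i) := by
  refine (hd _).isOrthogonal (hd _) hi fun hneg => pt_sub_one_ne_pt_add_one hm i ?_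
  have hprev := pt_add_one (i - 1)
  rw [sub_add_cancel] at hprev
  rw [pt_add_one i, hneg, hprev, add_neg_cancel_right]

theorem IsDiagonal.not_isCollinear_of_mem_turns (hd : S.IsDiagonal) (hm : 3 ≤ S.m) {i : ZMod S.m}
    (hi : i ∈ S.turns) {σ : Set (ℤ × ℤ)} (hprev : S.pt (i - 1) ∈ σ) (h : S.pt i ∈ σ)
    (hnext : S.pt (i + 1) ∈ σ) : ¬ IsCollinear σ := by
  intro hσ
  have horth := hd.isOrthogonal_step hm hi
  have hpt := pt_add_one (i - 1)
  rw [sub_add_cancel] at hpt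
  have hcross := hσ _ h _ hnext _ hprev
  rw [pt_add_one i, hpt] at hcross
  simp only [Prod.fst_add, Prod.snd_add, add_sub_cancel_left, sub_add_cancel_left] at hcross
  unfold IsOrthogonal at horth
  obtain ⟨hv₁ | hv₁, hv₂ | hv₂⟩ := hd (i - 1) <;>
    simp only [hv₁, hv₂] at horth hcross <;> have := (hd i).1 <;> omega

theorem IsSegmentArc.eq_start (hd : S.IsDiagonal) (hm : 3 ≤ S.m) {i t : ZMod S.m} {k : ℕ}
    (h : S.IsSegmentArc i k) (ht : t ∈ S.turns) (h0 : S.pt t ∈ S.arc i k)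
    (h1 : S.pt (t + 1) ∈ S.arc i k) : t = i := by
  obtain ⟨j, hj, hp⟩ := id h0
  obtain rfl := S.inj hp
  rcases Nat.eq_zero_or_pos j with rfl | hpos
  · simp
  · refine absurd h.2.2.2.2.2 (hd.not_isCollinear_of_mem_turns hm ht ?_ h0 h1)
    exact ⟨j - 1, by omega, by rw [Nat.cast_sub hpos, Nat.cast_one, add_sub_assoc]⟩

theorem IsSegmentArc.eq_end (hd : S.IsDiagonal) (hm : 3 ≤ S.m) {i t : ZMod S.m} {k : ℕ}
    (h : S.IsSegmentArc i k) (ht : t ∈ S.turns) (h0 : S.pt t ∈ S.arc i k)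
    (h1 : S.pt (t - 1) ∈ S.arc i k) : t = i + k := by
  obtain ⟨j, hj, hp⟩ := id h0
  obtain rfl := S.inj hp
  rcases hj.eq_or_lt with rfl | hlt
  · rfl
  · refine absurd h.2.2.2.2.2 (hd.not_isCollinear_of_mem_turns hm ht h1 h0 ?_)
    exact ⟨j + 1, hlt, by push_cast; rw [add_assoc]⟩

theorem IsSegmentArc.eq_of_arc_subset (hd : S.IsDiagonal) (hm : 3 ≤ S.m) {i t : ZMod S.m}
    {k l : ℕ} (h : S.IsSegmentArc i k) (hl : 1 ≤ l) (hlm : l < S.m) (ht : t ∈ S.turns)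
    (htl : t + l ∈ S.turns) (hsub : S.arc t l ⊆ S.arc i k) : t = i ∧ l = k := by
  obtain rfl : t = i :=
    h.eq_start hd hm ht (hsub (pt_mem_arc_self t l)) (hsub (pt_add_one_mem_arc t hl))
  refine ⟨rfl, eq_of_natCast_zmod_eq hlm h.2.1 (add_left_cancel (h.eq_end hd hm htl ?_ ?_))⟩
  · exact hsub (pt_mem_arc t le_rfl)
  · exact hsub ⟨l - 1, by omega, by rw [Nat.cast_sub hl, Nat.cast_one, add_sub_assoc]⟩

theorem step_add_of_forall_notMem_turns {i : ZMod S.m} {k : ℕ}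
    (h : ∀ j : ℕ, 1 ≤ j → j ≤ k → i + j ∉ S.turns) : S.step (i + k) = S.step i := by
  induction k with
  | zero => simp
  | succ k ih =>
    have hk : S.step (i + (k + 1 : ℕ)) = S.step (i + (k + 1 : ℕ) - 1) :=
      not_not.1 (h (k + 1) (by omega) le_rfl)
    rw [hk, ← ih fun j h1 h2 => h j h1 (by omega)]
    congr 1
    push_cast
    ring

theorem pt_add_of_forall_notMem_turns {i : ZMod S.m} {k : ℕ}
    (h : ∀ j : ℕ, 1 ≤ j → j < k → i + j ∉ S.turns) :
    S.pt (i + k) = S.pt i + (k : ℤ) • S.step i := by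
  induction k with
  | zero => simp
  | succ k ih =>
    have hstep : S.step (i + k) = S.step i :=
      step_add_of_forall_notMem_turns fun j h1 h2 => h j h1 (by omega)
    push_cast
    rw [← add_assoc, pt_add_one, hstep, ih fun j h1 h2 => h j h1 (by omega)]
    module

theorem IsDiagonal.exists_add_mem_turns (hd : S.IsDiagonal) (i : ZMod S.m) :
    ∃ k : ℕ, 1 ≤ k ∧ k < S.m ∧ i + k ∈ S.turns := by
  by_contra! hno
  have hclosed := pt_add_of_forall_notMem_turns hno
  rw [CharP.cast_eq_zero, add_zero, left_eq_add] at hclosed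
  exact NeZero.ne S.m (by exact_mod_cast (hd i).zsmul_eq_zero hclosed)

theorem IsDiagonal.runLength_mem (hd : S.IsDiagonal) (i : ZMod S.m) :
    S.runLength i ∈ {k : ℕ | 1 ≤ k ∧ i + k ∈ S.turns} := by
  obtain ⟨k, hk, -, hturn⟩ := hd.exists_add_mem_turns i
  exact Nat.sInf_mem ⟨k, hk, hturn⟩

theorem IsDiagonal.one_le_runLength (hd : S.IsDiagonal) (i : ZMod S.m) : 1 ≤ S.runLength i :=
  (hd.runLength_mem i).1

theorem IsDiagonal.nextTurn_mem_turns (hd : S.IsDiagonal) (i : ZMod S.m) :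
    S.nextTurn i ∈ S.turns :=
  (hd.runLength_mem i).2

theorem IsDiagonal.runLength_lt (hd : S.IsDiagonal) (i : ZMod S.m) : S.runLength i < S.m := by
  obtain ⟨k, hk, hkm, hturn⟩ := hd.exists_add_mem_turns i
  have hle : S.runLength i ≤ k := Nat.sInf_le ⟨hk, hturn⟩
  omega

theorem notMem_turns_of_lt_runLength {i : ZMod S.m} {j : ℕ} (h1 : 1 ≤ j)
    (hj : j < S.runLength i) : i + j ∉ S.turns :=
  fun h => Nat.notMem_of_lt_sInf hj ⟨h1, h⟩

theorem pt_add_of_le_runLength {i : ZMod S.m} {j : ℕ} (hj : j ≤ S.runLength i) :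
    S.pt (i + j) = S.pt i + (j : ℤ) • S.step i :=
  pt_add_of_forall_notMem_turns fun _ h1 h2 => notMem_turns_of_lt_runLength h1 (by omega)

theorem pt_nextTurn (i : ZMod S.m) :
    S.pt (S.nextTurn i) = S.pt i + (S.runLength i : ℤ) • S.step i :=
  pt_add_of_le_runLength le_rfl

theorem arc_runLength (i : ZMod S.m) :
    S.arc i (S.runLength i) = latticeSegment (S.pt i) (S.step i) (S.runLength i) := by
  ext p
  refine exists_congr fun j => and_congr_right fun hj => ?_
  rw [pt_add_of_le_runLength hj]

theorem IsDiagonal.isOrthogonal_step_nextTurn (hd : S.IsDiagonal) (hm : 3 ≤ S.m) (i : ZMod S.m) :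
    IsOrthogonal (S.step i) (S.step (S.nextTurn i)) := by
  have hpos := hd.one_le_runLength i
  have hturn := hd.nextTurn_mem_turns i
  have hlast : S.step (S.nextTurn i - 1) = S.step i := by
    have hidx : S.nextTurn i - 1 = i + (S.runLength i - 1 : ℕ) := by
      rw [nextTurn, Nat.cast_sub hpos, Nat.cast_one, add_sub_assoc]
    rw [hidx]
    exact step_add_of_forall_notMem_turns fun j h1 h2 =>
      notMem_turns_of_lt_runLength h1 (by omega)
  exact hlast ▸ hd.isOrthogonal_step hm hturn

theorem IsDiagonal.isSideArc_runLength (hd : S.IsDiagonal) (hm : 3 ≤ S.m) {t : ZMod S.m}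
    (ht : t ∈ S.turns) : S.IsSideArc t (S.runLength t) := by
  have hpos := hd.one_le_runLength t
  have hturn := hd.nextTurn_mem_turns t
  refine ⟨isSegmentArc_of_isCollinear hpos (hd.runLength_lt t) ?_, fun i k h hsub => ?_⟩
  · exact arc_runLength t ▸ isCollinear_latticeSegment _ _ _
  · obtain ⟨rfl, rfl⟩ := h.eq_of_arc_subset hd hm hpos (hd.runLength_lt t) ht hturn hsub
    rfl

theorem IsDiagonal.exists_turn_add (hd : S.IsDiagonal) (z : ZMod S.m) :
    ∃ t ∈ S.turns, ∃ j < S.runLength t, z = t + j := by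
  have from_turn : ∀ n : ℕ, ∀ t ∈ S.turns,
      ∃ t' ∈ S.turns, ∃ j < S.runLength t', t + (n : ZMod S.m) = t' + j := by
    intro n
    induction n using Nat.strong_induction_on with
    | _ n ih =>
      intro t ht
      rcases lt_or_ge n (S.runLength t) with hlt | hge
      · exact ⟨t, ht, n, hlt, rfl⟩
      · have hpos := hd.one_le_runLength t
        have hturn := hd.nextTurn_mem_turns t
        obtain ⟨t', ht', j, hj, heq⟩ := ih (n - S.runLength t) (by omega) _ hturn
        refine ⟨t', ht', j, hj, heq ▸ ?_⟩
        rw [nextTurn, Nat.cast_sub hge]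
        ring
  obtain ⟨k, -, -, hturn⟩ := hd.exists_add_mem_turns z
  obtain ⟨t, ht, j, hj, heq⟩ := from_turn (z - (z + k)).val _ hturn
  exact ⟨t, ht, j, hj, by rw [← heq, ZMod.natCast_zmod_val, add_sub_cancel]⟩

theorem IsDiagonal.isSideArc_iff (hd : S.IsDiagonal) (hm : 3 ≤ S.m) {i : ZMod S.m} {k : ℕ} :
    S.IsSideArc i k ↔ i ∈ S.turns ∧ k = S.runLength i := by
  refine ⟨fun ⟨hseg, hmax⟩ => ?_, fun ⟨hi, hk⟩ => hk ▸ hd.isSideArc_runLength hm hi⟩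
  obtain ⟨t, ht, j, hj, rfl⟩ := hd.exists_turn_add i
  have hpos := hd.one_le_runLength t
  have hturn := hd.nextTurn_mem_turns t
  have hend : j + k ≤ S.runLength t := by
    by_contra! hlt
    have hidx : S.nextTurn t = t + j + (S.runLength t - j : ℕ) := by
      rw [nextTurn, Nat.cast_sub hj.le]
      ring
    have hstart : S.nextTurn t = t + j := by
      refine hseg.eq_start hd hm hturn ⟨S.runLength t - j, by omega, by rw [hidx]⟩
        ⟨S.runLength t - j + 1, by omega, ?_⟩
      rw [hidx, add_assoc, Nat.cast_succ]
    have := eq_of_natCast_zmod_eq (hd.runLength_lt t) (hj.trans (hd.runLength_lt t))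
      (add_left_cancel hstart)
    omega
  have hsub : S.arc (t + j) k ⊆ S.arc t (S.runLength t) := by
    rintro _ ⟨l, hl, rfl⟩
    exact ⟨j + l, by omega, by push_cast; rw [add_assoc]⟩
  have heq := hmax _ _ (hd.isSideArc_runLength hm ht).1 hsub
  obtain ⟨hstart, hlen⟩ :=
    hseg.eq_of_arc_subset hd hm hpos (hd.runLength_lt t) ht hturn heq.subset
  rw [← hstart]
  exact ⟨ht, hlen.symm⟩

theorem IsDiagonal.ncard_sides (hd : S.IsDiagonal) (hm : 3 ≤ S.m) :
    S.sides.ncard = S.turns.ncard := by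
  have hsides : S.sides = (fun t => S.arc t (S.runLength t)) '' S.turns := by
    ext σ
    constructor
    · rintro ⟨i, k, hside, rfl⟩
      obtain ⟨hi, rfl⟩ := (hd.isSideArc_iff hm).1 hside
      exact ⟨i, hi, rfl⟩
    · rintro ⟨t, ht, rfl⟩
      exact ⟨t, _, hd.isSideArc_runLength hm ht, rfl⟩
  rw [hsides]
  refine Set.InjOn.ncard_image fun t ht t' ht' heq => ?_
  have hpos := hd.one_le_runLength t
  have hturn := hd.nextTurn_mem_turns t
  exact ((hd.isSideArc_runLength hm ht').1.eq_of_arc_subset hd hm hpos (hd.runLength_lt t) ht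
    hturn heq.subset).1

theorem IsDiagonal.sideEndpoints_eq (hd : S.IsDiagonal) (hm : 3 ≤ S.m) :
    S.sideEndpoints = S.pt '' S.turns := by
  ext p
  constructor
  · rintro ⟨i, k, hside, hp⟩
    obtain ⟨hi, rfl⟩ := (hd.isSideArc_iff hm).1 hside
    rcases hp with rfl | rfl
    · exact ⟨i, hi, rfl⟩
    · exact ⟨_, hd.nextTurn_mem_turns i, rfl⟩
  · rintro ⟨t, ht, rfl⟩
    exact ⟨t, _, hd.isSideArc_runLength hm ht, Or.inl rfl⟩

theorem IsDiagonal.carrier_eq_iUnion (hd : S.IsDiagonal) :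
    S.carrier = ⋃ t ∈ S.turns, latticeSegment (S.pt t) (S.step t) (S.runLength t) := by
  simp only [← arc_runLength]
  refine Set.Subset.antisymm ?_ (Set.iUnion₂_subset fun t _ => arc_subset_carrier _ _)
  rintro _ ⟨z, rfl⟩
  obtain ⟨t, ht, j, hj, rfl⟩ := hd.exists_turn_add z
  exact Set.mem_biUnion ht (pt_mem_arc t hj.le)

/-! ### Diagonal curves with four turns -/

theorem IsDiagonal.nextTurn_ne (hd : S.IsDiagonal) (i : ZMod S.m) : S.nextTurn i ≠ i := by
  intro h
  have hpt := pt_nextTurn i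
  rw [h, left_eq_add] at hpt
  have := (hd i).zsmul_eq_zero hpt
  have := hd.one_le_runLength i
  omega

theorem IsDiagonal.nextTurn_nextTurn_ne (hd : S.IsDiagonal) (hm : 3 ≤ S.m) (i : ZMod S.m) :
    S.nextTurn (S.nextTurn i) ≠ i := by
  intro h
  have hpt := pt_nextTurn (S.nextTurn i)
  rw [h, pt_nextTurn i, add_assoc, left_eq_add] at hpt
  have := (hd i).zsmul_add_zsmul_eq_zero (hd _) (hd.isOrthogonal_step_nextTurn hm i) hpt
  have := hd.one_le_runLength i
  omega

theorem IsDiagonal.nextTurn_nextTurn_nextTurn_ne (hd : S.IsDiagonal) (hm : 3 ≤ S.m)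
    (i : ZMod S.m) : S.nextTurn (S.nextTurn (S.nextTurn i)) ≠ i := by
  intro h
  have hpt := pt_nextTurn (S.nextTurn (S.nextTurn i))
  rw [h, pt_nextTurn (S.nextTurn i), pt_nextTurn i, add_assoc, add_assoc, left_eq_add,
    ← add_assoc] at hpt
  have := hd.one_le_runLength (S.nextTurn i)
  exact (hd i).zsmul_add_zsmul_add_zsmul_ne_zero (hd _) (hd _) (hd.isOrthogonal_step_nextTurn hm i)
    (hd.isOrthogonal_step_nextTurn hm _) (by omega) hpt

theorem IsDiagonal.turns_eq_of_ncard_eq_four (hd : S.IsDiagonal) (hm : 3 ≤ S.m)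
    (hfour : S.turns.ncard = 4) {i : ZMod S.m} (hi : i ∈ S.turns) :
    S.turns = {i, S.nextTurn i, S.nextTurn (S.nextTurn i),
      S.nextTurn (S.nextTurn (S.nextTurn i))} := by
  have hturn : ∀ j, S.nextTurn j ∈ S.turns := fun j => hd.nextTurn_mem_turns j
  refine (Set.eq_of_subset_of_ncard_le ?_ ?_ (Set.toFinite _)).symm
  · simp only [Set.insert_subset_iff, Set.singleton_subset_iff, hi, hturn, and_self]
  · have hne₁ := fun j => (hd.nextTurn_ne j).symm
    have hne₂ := fun j => (hd.nextTurn_nextTurn_ne hm j).symm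
    have hne₃ := fun j => (hd.nextTurn_nextTurn_nextTurn_ne hm j).symm
    rw [hfour, Set.ncard_insert_of_notMem (by simp [hne₁, hne₂, hne₃]),
      Set.ncard_insert_of_notMem (by simp [hne₁, hne₂]), Set.ncard_pair (hne₁ _)]

theorem IsDiagonal.nextTurn_nextTurn_nextTurn_nextTurn (hd : S.IsDiagonal) (hm : 3 ≤ S.m)
    (hfour : S.turns.ncard = 4) {i : ZMod S.m} (hi : i ∈ S.turns) :
    S.nextTurn (S.nextTurn (S.nextTurn (S.nextTurn i))) = i := by
  have hmem := hd.nextTurn_mem_turns (S.nextTurn (S.nextTurn (S.nextTurn i)))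
  rw [hd.turns_eq_of_ncard_eq_four hm hfour hi] at hmem
  rcases hmem with h | h | h | h
  · exact h
  · exact absurd h (hd.nextTurn_nextTurn_nextTurn_ne hm _)
  · exact absurd h (hd.nextTurn_nextTurn_ne hm _)
  · exact absurd h (hd.nextTurn_ne _)

theorem IsDiagonal.opposite_runs (hd : S.IsDiagonal) (hm : 3 ≤ S.m)
    (hfour : S.turns.ncard = 4) {i : ZMod S.m} (hi : i ∈ S.turns) :
    S.step (S.nextTurn (S.nextTurn i)) = -S.step i ∧
      S.runLength (S.nextTurn (S.nextTurn i)) = S.runLength i := by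
  have hclosed := pt_nextTurn (S.nextTurn (S.nextTurn (S.nextTurn i)))
  simp only [hd.nextTurn_nextTurn_nextTurn_nextTurn hm hfour hi, pt_nextTurn, add_assoc,
    left_eq_add] at hclosed
  have hpos : ∀ j, 0 < (S.runLength j : ℤ) := fun j => by
    have := hd.one_le_runLength j
    omega
  have horth := hd.isOrthogonal_step_nextTurn hm
  obtain ⟨hstep, -, hlen, -⟩ := IsDiagonalStep.rectangle_of_closed (hd _) (hd _) (hd _) (hd _)
    (horth _) (horth _) (horth _) (hpos _) (hpos _) (hpos _) (hpos _)
    (by simpa only [add_assoc] using hclosed)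
  exact ⟨hstep, by exact_mod_cast hlen⟩

end ClosedCurve

/-- The lattice points on the sides of the parallelogram with vertex `c` whose sides at `c` are
`a • e` and `b • f`. -/
def parallelogramBoundary (c e f : ℤ × ℤ) (a b : ℕ) : Set (ℤ × ℤ) :=
  latticeSegment c e a ∪ latticeSegment (c + (a : ℤ) • e) f b ∪
    latticeSegment (c + (b : ℤ) • f) e a ∪ latticeSegment c f b

/-- The vertices of the parallelogram with vertex `c` whose sides at `c` are `a • e` and
`b • f`. -/
def parallelogramVertices (c e f : ℤ × ℤ) (a b : ℕ) : Set (ℤ × ℤ) :=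
  {c, c + (a : ℤ) • e, c + (a : ℤ) • e + (b : ℤ) • f, c + (b : ℤ) • f}

theorem parallelogramBoundary_swap (c e f : ℤ × ℤ) (a b : ℕ) :
    parallelogramBoundary c f e b a = parallelogramBoundary c e f a b := by
  ext p
  simp only [parallelogramBoundary, Set.mem_union]
  tauto

theorem parallelogramVertices_swap (c e f : ℤ × ℤ) (a b : ℕ) :
    parallelogramVertices c f e b a = parallelogramVertices c e f a b := by
  ext p
  simp only [parallelogramVertices, Set.mem_insert_iff, Set.mem_singleton_iff,
    add_right_comm c ((b : ℤ) • f)]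
  tauto

namespace ClosedCurve

variable {S : ClosedCurve}

theorem IsDiagonal.exists_parallelogram_at (hd : S.IsDiagonal) (hm : 3 ≤ S.m)
    (hfour : S.turns.ncard = 4) {i : ZMod S.m} (hi : i ∈ S.turns) :
    ∃ e f : ℤ × ℤ, ∃ a b : ℕ, IsDiagonalStep e ∧ IsDiagonalStep f ∧ IsOrthogonal e f ∧
      1 ≤ a ∧ 1 ≤ b ∧ S.carrier = parallelogramBoundary (S.pt i) e f a b ∧
      S.pt '' S.turns = parallelogramVertices (S.pt i) e f a b := by
  have hturns := hd.turns_eq_of_ncard_eq_four hm hfour hi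
  have hopp₁ := hd.opposite_runs hm hfour hi
  have hopp₂ := hd.opposite_runs hm hfour (hd.nextTurn_mem_turns i)
  have hpt₁ := pt_nextTurn i
  have hpt₂ := pt_nextTurn (S.nextTurn i)
  have hpt₃ : S.pt (S.nextTurn (S.nextTurn (S.nextTurn i))) =
      S.pt i + (S.runLength (S.nextTurn i) : ℤ) • S.step (S.nextTurn i) := by
    rw [pt_nextTurn, hpt₂, hpt₁, hopp₁.1, hopp₁.2]
    module
  refine ⟨S.step i, S.step (S.nextTurn i), S.runLength i, S.runLength (S.nextTurn i), hd _, hd _,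
    hd.isOrthogonal_step_nextTurn hm i, hd.one_le_runLength _, hd.one_le_runLength _, ?_, ?_⟩
  · have hside₃ := latticeSegment_reverse
      (S.pt i + (S.runLength (S.nextTurn i) : ℤ) • S.step (S.nextTurn i)) (S.step i)
      (S.runLength i)
    have hside₄ := latticeSegment_reverse (S.pt i) (S.step (S.nextTurn i))
      (S.runLength (S.nextTurn i))
    rw [hd.carrier_eq_iUnion, hturns, parallelogramBoundary, ← hside₃, ← hside₄]
    simp only [Set.biUnion_insert, Set.biUnion_singleton, hopp₁, hopp₂, hpt₁, hpt₂, hpt₃,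
      Set.union_assoc, add_right_comm (S.pt i) ((S.runLength i : ℤ) • S.step i)]
  · rw [hturns]
    simp only [Set.image_insert_eq, Set.image_singleton, hpt₁, hpt₂, hpt₃, parallelogramVertices]

end ClosedCurve

/-! ### Slanted rectangles -/

/-- The lattice points of the slanted rectangle whose leftmost corner is `c` and whose sides of
slope `1` and `-1` have `a` and `b` steps. -/
def slantedRect (c : ℤ × ℤ) (a b : ℕ) : Set (ℤ × ℤ) :=
  {p | (0 ≤ (p.1 - c.1) + (p.2 - c.2) ∧ (p.1 - c.1) + (p.2 - c.2) ≤ 2 * a) ∧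
    (0 ≤ (p.1 - c.1) - (p.2 - c.2) ∧ (p.1 - c.1) - (p.2 - c.2) ≤ 2 * b)}

/-- The points on the four sides of `slantedRect c a b`. -/
def slantedBoundary (c : ℤ × ℤ) (a b : ℕ) : Set (ℤ × ℤ) :=
  {p | p ∈ slantedRect c a b ∧
    ((p.1 - c.1) + (p.2 - c.2) = 0 ∨ (p.1 - c.1) + (p.2 - c.2) = 2 * a ∨
      (p.1 - c.1) - (p.2 - c.2) = 0 ∨ (p.1 - c.1) - (p.2 - c.2) = 2 * b)}

/-- The corners of `slantedRect c a b`. -/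
def slantedCorners (c : ℤ × ℤ) (a b : ℕ) : Set (ℤ × ℤ) :=
  {p | ((p.1 - c.1) + (p.2 - c.2) = 0 ∨ (p.1 - c.1) + (p.2 - c.2) = 2 * a) ∧
    ((p.1 - c.1) - (p.2 - c.2) = 0 ∨ (p.1 - c.1) - (p.2 - c.2) = 2 * b)}

theorem slantedCorners_subset_slantedRect (c : ℤ × ℤ) (a b : ℕ) :
    slantedCorners c a b ⊆ slantedRect c a b := by
  intro p hp
  simp only [slantedRect, slantedCorners, Set.mem_ofPred_eq] at hp ⊢
  omega

theorem slantedRect_finite (c : ℤ × ℤ) (a b : ℕ) : (slantedRect c a b).Finite := by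
  refine (Set.finite_Icc (c.1, c.2 - b) (c.1 + a + b, c.2 + a)).subset ?_
  rintro ⟨x, y⟩ h
  simp only [slantedRect, Set.mem_ofPred_eq] at h
  simp only [Set.mem_Icc, Prod.mk_le_mk]
  omega

theorem mem_latticeSegment_one_one {p q : ℤ × ℤ} {n : ℕ} :
    q ∈ latticeSegment p (1, 1) n ↔
      0 ≤ q.1 - p.1 ∧ q.1 - p.1 ≤ n ∧ q.2 - p.2 = q.1 - p.1 := by
  simp only [latticeSegment, Set.mem_ofPred_eq, Prod.ext_iff, Prod.fst_add, Prod.snd_add,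
    Prod.smul_fst, Prod.smul_snd, smul_eq_mul]
  exact ⟨fun ⟨j, h⟩ => by omega, fun h => ⟨(q.1 - p.1).toNat, by omega⟩⟩

theorem mem_latticeSegment_one_neg_one {p q : ℤ × ℤ} {n : ℕ} :
    q ∈ latticeSegment p (1, -1) n ↔
      0 ≤ q.1 - p.1 ∧ q.1 - p.1 ≤ n ∧ q.2 - p.2 = -(q.1 - p.1) := by
  simp only [latticeSegment, Set.mem_ofPred_eq, Prod.ext_iff, Prod.fst_add, Prod.snd_add,
    Prod.smul_fst, Prod.smul_snd, smul_eq_mul]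
  exact ⟨fun ⟨j, h⟩ => by omega, fun h => ⟨(q.1 - p.1).toNat, by omega⟩⟩

theorem parallelogramBoundary_eq_slantedBoundary (c : ℤ × ℤ) (a b : ℕ) :
    parallelogramBoundary c (1, 1) (1, -1) a b = slantedBoundary c a b := by
  ext p
  simp only [parallelogramBoundary, slantedBoundary, slantedRect, Set.mem_union,
    mem_latticeSegment_one_one, mem_latticeSegment_one_neg_one, Set.mem_ofPred_eq, Prod.fst_add,
    Prod.snd_add, Prod.smul_fst, Prod.smul_snd, smul_eq_mul]
  omega

theorem parallelogramVertices_eq_slantedCorners (c : ℤ × ℤ) (a b : ℕ) :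
    parallelogramVertices c (1, 1) (1, -1) a b = slantedCorners c a b := by
  ext p
  simp only [parallelogramVertices, slantedCorners, Set.mem_insert_iff, Set.mem_singleton_iff,
    Set.mem_ofPred_eq, Prod.ext_iff, Prod.fst_add, Prod.snd_add, Prod.smul_fst, Prod.smul_snd,
    smul_eq_mul]
  omega

theorem IsDiagonalStep.eq_or_eq_of_fst_eq_one {e f : ℤ × ℤ} (he : IsDiagonalStep e)
    (hf : IsDiagonalStep f) (hef : IsOrthogonal e f) (he₁ : e.1 = 1) (hf₁ : f.1 = 1) :
    (e = (1, 1) ∧ f = (1, -1)) ∨ (e = (1, -1) ∧ f = (1, 1)) := by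
  have he₂ := he.2
  obtain ⟨e₁, e₂⟩ := e
  obtain ⟨f₁, f₂⟩ := f
  dsimp only [IsOrthogonal] at hef he₁ he₂ hf₁
  subst he₁ hf₁
  simp only [Prod.mk.injEq, true_and]
  rcases he₂ with rfl | rfl <;> omega

namespace ClosedCurve

variable {S : ClosedCurve}

theorem IsDiagonal.exists_slantedRect (hd : S.IsDiagonal) (hm : 3 ≤ S.m)
    (hfour : S.turns.ncard = 4) : ∃ c a b, 1 ≤ a ∧ 1 ≤ b ∧ S.carrier = slantedBoundary c a b ∧
      S.pt '' S.turns = slantedCorners c a b := by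
  obtain ⟨i, hi, hleft⟩ := S.turns.exists_min_image (fun i => (S.pt i).1) (Set.toFinite _)
    (Set.nonempty_of_ncard_ne_zero (by omega))
  obtain ⟨e, f, a, b, he, hf, hef, ha, hb, hcarrier, hvertices⟩ :=
    hd.exists_parallelogram_at hm hfour hi
  have hmin : ∀ p ∈ parallelogramVertices (S.pt i) e f a b, (S.pt i).1 ≤ p.1 := by
    rw [← hvertices]
    exact Set.forall_mem_image.2 hleft
  simp only [parallelogramVertices, Set.forall_mem_insert, Set.mem_singleton_iff, forall_eq,
    Prod.fst_add, Prod.smul_fst, smul_eq_mul] at hmin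
  obtain ⟨-, hae, -, hbf⟩ := hmin
  have he₁ : e.1 = 1 := he.1.resolve_right fun h => by rw [h] at hae; omega
  have hf₁ : f.1 = 1 := hf.1.resolve_right fun h => by rw [h] at hbf; omega
  rcases he.eq_or_eq_of_fst_eq_one hf hef he₁ hf₁ with ⟨rfl, rfl⟩ | ⟨rfl, rfl⟩
  · exact ⟨S.pt i, a, b, ha, hb, hcarrier.trans (parallelogramBoundary_eq_slantedBoundary _ _ _),
      hvertices.trans (parallelogramVertices_eq_slantedCorners _ _ _)⟩
  · rw [← parallelogramBoundary_swap, parallelogramBoundary_eq_slantedBoundary] at hcarrier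
    rw [← parallelogramVertices_swap, parallelogramVertices_eq_slantedCorners] at hvertices
    exact ⟨S.pt i, b, a, hb, ha, hcarrier, hvertices⟩

theorem exists_slantedRect (hfour : S.sides.ncard = 4) (hslanted : ∀ σ ∈ S.sides, IsSlanted σ) :
    ∃ c a b, 1 ≤ a ∧ 1 ≤ b ∧ S.carrier = slantedBoundary c a b ∧
      S.sideEndpoints = slantedCorners c a b := by
  have hm : 3 ≤ S.m := three_le_m (by omega)
  have hd := isDiagonal_of_isSlanted (by omega) hslanted
  rw [hd.sideEndpoints_eq hm]
  exact hd.exists_slantedRect hm (hd.ncard_sides hm ▸ hfour)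

theorem notMem_interior_of_injective_path {r : ℕ → ℤ × ℤ} (hinj : Function.Injective r)
    (hadj : ∀ n, c1.Adj (r n) (r (n + 1))) (hoff : ∀ n, r n ∉ S.carrier) : r 0 ∉ S.interior := by
  rintro ⟨h0, hfin⟩
  have hreach : ∀ n, S.complGraph.Reachable ⟨r n, hoff n⟩ ⟨r 0, h0⟩ := by
    intro n
    induction n with
    | zero => rfl
    | succ n ih =>
      have hback : S.complGraph.Adj ⟨r (n + 1), hoff (n + 1)⟩ ⟨r n, hoff n⟩ := (hadj n).symm
      exact hback.reachable.trans ih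
  refine Set.infinite_of_injective_forall_mem
    (f := fun n => (⟨r n, hoff n⟩ : (S.carrierᶜ : Set (ℤ × ℤ)))) ?_ ?_ hfin
  · exact fun m n h => hinj (congrArg Subtype.val h)
  · exact fun n => SimpleGraph.ConnectedComponent.sound (hreach n)

theorem mem_interior_of_finite {R : Set (ℤ × ℤ)} (hR : R.Finite)
    (hclosed : ∀ x ∈ R \ S.carrier, ∀ y ∉ S.carrier, c1.Adj x y → y ∈ R) {p : ℤ × ℤ}
    (hpR : p ∈ R) (hp : p ∉ S.carrier) : p ∈ S.interior := by
  have hwalk : ∀ x y, S.complGraph.Walk x y → (x : ℤ × ℤ) ∈ R → (y : ℤ × ℤ) ∈ R := by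
    intro x y w
    induction w with
    | nil => exact id
    | @cons x z _ hadj _ ih => exact fun hx => ih (hclosed x ⟨hx, x.2⟩ z z.2 hadj)
  refine ⟨hp, Set.Finite.of_finite_image (f := Subtype.val) (hR.subset ?_)
    Subtype.val_injective.injOn⟩
  rintro _ ⟨q, hq, rfl⟩
  obtain ⟨w⟩ := (SimpleGraph.ConnectedComponent.exact hq).symm
  exact hwalk _ _ w hpR

theorem notMem_interior_of_ray {p v : ℤ × ℤ} (hv : c1.Adj 0 v)
    (hray : ∀ n : ℕ, p + (n : ℤ) • v ∉ S.carrier) : p ∉ S.interior := by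
  have hstart : p + ((0 : ℕ) : ℤ) • v = p := by simp
  rw [← hstart]
  refine notMem_interior_of_injective_path (r := fun n : ℕ => p + (n : ℤ) • v) ?_ ?_ hray
  · intro m n h
    exact_mod_cast smul_left_injective ℤ hv.ne' (add_left_cancel h)
  · intro n
    obtain ⟨hne, h₁, h₂, h₃⟩ := hv
    have hnext : p + ((n + 1 : ℕ) : ℤ) • v = p + (n : ℤ) • v + v := by push_cast; module
    simp only [hnext]
    refine ⟨by simpa [eq_comm] using hne, ?_, ?_, ?_⟩
    · simpa only [Prod.fst_add, Prod.fst_zero, zero_sub, sub_add_cancel_left] using h₁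
    · simpa only [Prod.snd_add, Prod.snd_zero, zero_sub, sub_add_cancel_left] using h₂
    · simpa [eq_comm] using h₃

theorem mem_slantedRect_of_mem_interior {c : ℤ × ℤ} {a b : ℕ}
    (hS : S.carrier = slantedBoundary c a b) {p : ℤ × ℤ} (hp : p ∈ S.interior) :
    p ∈ slantedRect c a b := by
  by_contra hout
  by_cases hleft : (p.1 - c.1) + (p.2 - c.2) < 0 ∨ (p.1 - c.1) - (p.2 - c.2) < 0
  · refine notMem_interior_of_ray (v := (-1, 0)) (by simp [c1, Prod.ext_iff]) (fun n => ?_) hp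
    simp only [hS, slantedBoundary, slantedRect, Set.mem_ofPred_eq, Prod.fst_add, Prod.snd_add,
      Prod.smul_fst, Prod.smul_snd, smul_eq_mul]
    omega
  · refine notMem_interior_of_ray (v := (1, 0)) (by simp [c1, Prod.ext_iff]) (fun n => ?_) hp
    simp only [hS, slantedBoundary, slantedRect, Set.mem_ofPred_eq, Prod.fst_add, Prod.snd_add,
      Prod.smul_fst, Prod.smul_snd, smul_eq_mul] at hout ⊢
    omega

theorem carrier_union_interior {c : ℤ × ℤ} {a b : ℕ} (hS : S.carrier = slantedBoundary c a b) :
    S.carrier ∪ S.interior = slantedRect c a b := by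
  refine Set.Subset.antisymm (Set.union_subset ?_ fun p => mem_slantedRect_of_mem_interior hS) ?_
  · exact hS ▸ fun p hp => hp.1
  · refine fun p hp => or_iff_not_imp_left.2 <|
      mem_interior_of_finite (slantedRect_finite c a b) (fun x hx y hy hxy => ?_) hp
    obtain ⟨-, h₁, h₂, h₃⟩ := hxy
    simp only [hS, slantedBoundary, slantedRect, Set.mem_sdiff, Set.mem_ofPred_eq, abs_le] at *
    omega

end ClosedCurve

/-! ### Continuous maps and lattice segments -/

section Continuity

variable {V : Type*} {G : SimpleGraph V} {f : V → V} {φ : V → ℤ}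

theorem IsContinuous.eq_or_adj (hf : IsContinuous G f) {x y : V} (h : G.Adj x y) :
    f x = f y ∨ G.Adj (f x) (f y) := by
  refine or_iff_not_imp_left.2 fun hne => ?_
  obtain ⟨w⟩ := hf {x, y} (G.induce_pair_connected_of_adj h).preconnected
    ⟨f x, x, by simp, rfl⟩ ⟨f y, y, by simp, rfl⟩
  obtain ⟨⟨_, z, hz, rfl⟩, hadj, -, -⟩ :=
    w.exists_eq_cons_of_ne fun h => hne (congrArg Subtype.val h)
  rcases hz with rfl | rfl
  · exact (hadj.ne rfl).elim
  · exact hadj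

theorem isContinuous_of_eq_or_adj (hf : ∀ x y, G.Adj x y → f x = f y ∨ G.Adj (f x) (f y)) :
    IsContinuous G f := by
  intro Y hY
  have image_reachable : ∀ x y : Y, (G.induce Y).Walk x y → (G.induce (f '' Y)).Reachable
      ⟨f x, x, x.2, rfl⟩ ⟨f y, y, y.2, rfl⟩ := by
    intro x y w
    induction w with
    | nil => rfl
    | @cons x z y hadj _ ih =>
      refine SimpleGraph.Reachable.trans (reachable_of_eq_or_adj ?_) ih
      exact (hf x z hadj).imp Subtype.ext id
  rintro ⟨_, x, hx, rfl⟩ ⟨_, y, hy, rfl⟩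
  obtain ⟨w⟩ := hY ⟨x, hx⟩ ⟨y, hy⟩
  exact image_reachable _ _ w

theorem le_add_length_of_forall_adj (hφ : ∀ x y, G.Adj x y → φ y ≤ φ x + 1) {x y : V}
    (w : G.Walk x y) : φ y ≤ φ x + w.length := by
  induction w with
  | nil => simp
  | cons hadj w ih =>
    have := hφ _ _ hadj
    push_cast [SimpleGraph.Walk.length_cons]
    omega

theorem IsContinuous.apply_eq_of_walks (hf : IsContinuous G f)
    (hφ : ∀ x y, G.Adj x y → φ y ≤ φ x + 1) {p x q : V} (hp : φ (f p) = φ p)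
    (hq : φ (f q) = φ q) (w : G.Walk p x) (w' : G.Walk x q)
    (hlen : w.length + w'.length ≤ φ q - φ p) : φ (f x) = φ x := by
  have hφf : ∀ y z, G.Adj y z → φ (f z) ≤ φ (f y) + 1 := fun y z h => by
    rcases hf.eq_or_adj h with heq | hadj
    · rw [heq]
      omega
    · exact hφ _ _ hadj
  have h₁ := le_add_length_of_forall_adj hφ w
  have h₂ := le_add_length_of_forall_adj hφ w'
  have h₃ := le_add_length_of_forall_adj (φ := φ ∘ f) hφf w
  have h₄ := le_add_length_of_forall_adj (φ := φ ∘ f) hφf w'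
  simp only [Function.comp_apply] at h₃ h₄
  omega

end Continuity

theorem c2_adj_add_right {e : ℤ × ℤ} (he : c2.Adj 0 e) (p : ℤ × ℤ) : c2.Adj p (p + e) := by
  obtain ⟨hne, h₁, h₂⟩ := he
  refine ⟨by simpa [eq_comm] using hne, ?_, ?_⟩
  · simpa only [Prod.fst_add, Prod.fst_zero, zero_sub, sub_add_cancel_left] using h₁
  · simpa only [Prod.snd_add, Prod.snd_zero, zero_sub, sub_add_cancel_left] using h₂

section Segment

variable {X : Set (ℤ × ℤ)} {e : ℤ × ℤ} {n : ℕ}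

theorem exists_walk_of_latticeSegment_subset (he : c2.Adj 0 e) {p q : X}
    (hq : (q : ℤ × ℤ) = p + (n : ℤ) • e) (hX : latticeSegment p e n ⊆ X) :
    ∃ w : (c2.induce X).Walk p q, w.length = n := by
  induction n generalizing q with
  | zero =>
    obtain rfl : q = p := Subtype.ext (by simpa using hq)
    exact ⟨.nil, rfl⟩
  | succ n ih =>
    obtain ⟨w, hw⟩ := ih (q := ⟨p + (n : ℤ) • e, hX ⟨n, n.le_succ, rfl⟩⟩) rfl
      fun r ⟨j, hj, hr⟩ => hX ⟨j, by omega, hr⟩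
    have hlast : (c2.induce X).Adj ⟨p + (n : ℤ) • e, hX ⟨n, n.le_succ, rfl⟩⟩ q := by
      have hnext : (q : ℤ × ℤ) = p + (n : ℤ) • e + e := by rw [hq]; push_cast; module
      simpa [hnext] using c2_adj_add_right he (p + (n : ℤ) • e)
    exact ⟨w.concat hlast, by rw [SimpleGraph.Walk.length_concat, hw]⟩

variable {f : X → X} {p q x : X}

theorem IsContinuous.apply_eq_of_mem_latticeSegment (hf : IsContinuous (c2.induce X) f)
    (he : c2.Adj 0 e) (hX : latticeSegment p e n ⊆ X) (hx : (x : ℤ × ℤ) ∈ latticeSegment p e n)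
    (hq : (q : ℤ × ℤ) = p + (n : ℤ) • e) (hfp : f p = p) (hfq : f q = q) {φ : ℤ × ℤ → ℤ}
    (hφ : ∀ y z, c2.Adj y z → φ z ≤ φ y + 1) (hφn : φ q = φ p + n) : φ (f x) = φ x := by
  obtain ⟨j, hj, hxj⟩ := hx
  obtain ⟨w, hw⟩ := exists_walk_of_latticeSegment_subset he hxj
    fun r ⟨i, hi, hr⟩ => hX ⟨i, by omega, hr⟩
  obtain ⟨w', hw'⟩ := exists_walk_of_latticeSegment_subset he (n := n - j) (p := x) (q := q)
    (by rw [hq, hxj, Nat.cast_sub hj]; module)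
    fun r ⟨i, hi, hr⟩ => hX ⟨j + i, by omega, by rw [hr, hxj]; push_cast; module⟩
  exact hf.apply_eq_of_walks (φ := fun y : X => φ y) (fun y z h => hφ y z h) (by rw [hfp])
    (by rw [hfq]) w w' (by omega)

theorem IsContinuous.fst_apply_of_mem_latticeSegment (hf : IsContinuous (c2.induce X) f)
    (he : c2.Adj 0 e) (he₁ : e.1 = 1 ∨ e.1 = -1) (hX : latticeSegment p e n ⊆ X)
    (hx : (x : ℤ × ℤ) ∈ latticeSegment p e n) (hq : (q : ℤ × ℤ) = p + (n : ℤ) • e)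
    (hfp : f p = p) (hfq : f q = q) : (f x : ℤ × ℤ).1 = (x : ℤ × ℤ).1 := by
  have hfix := hf.apply_eq_of_mem_latticeSegment he hX hx hq hfp hfq (φ := fun z => e.1 * z.1)
    (fun y z ⟨_, h, _⟩ => by rw [abs_le] at h; rcases he₁ with h₁ | h₁ <;> rw [h₁] <;> omega)
    (by rcases he₁ with h₁ | h₁ <;> simp [hq, h₁, add_comm])
  rcases he₁ with h₁ | h₁ <;> simpa [h₁] using hfix

theorem IsContinuous.snd_apply_of_mem_latticeSegment (hf : IsContinuous (c2.induce X) f)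
    (he : c2.Adj 0 e) (he₂ : e.2 = 1 ∨ e.2 = -1) (hX : latticeSegment p e n ⊆ X)
    (hx : (x : ℤ × ℤ) ∈ latticeSegment p e n) (hq : (q : ℤ × ℤ) = p + (n : ℤ) • e)
    (hfp : f p = p) (hfq : f q = q) : (f x : ℤ × ℤ).2 = (x : ℤ × ℤ).2 := by
  have hfix := hf.apply_eq_of_mem_latticeSegment he hX hx hq hfp hfq (φ := fun z => e.2 * z.2)
    (fun y z ⟨_, _, h⟩ => by rw [abs_le] at h; rcases he₂ with h₂ | h₂ <;> rw [h₂] <;> omega)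
    (by rcases he₂ with h₂ | h₂ <;> simp [hq, h₂, add_comm])
  rcases he₂ with h₂ | h₂ <;> simpa [h₂] using hfix

theorem IsContinuous.apply_eq_self_of_isDiagonalStep (hf : IsContinuous (c2.induce X) f)
    (he : IsDiagonalStep e) (hX : latticeSegment p e n ⊆ X)
    (hx : (x : ℤ × ℤ) ∈ latticeSegment p e n) (hq : (q : ℤ × ℤ) = p + (n : ℤ) • e)
    (hfp : f p = p) (hfq : f q = q) : f x = x := by
  have hadj : c2.Adj 0 e := by
    obtain ⟨h₁, h₂⟩ := he
    refine ⟨fun h => ?_, abs_le.2 ?_, abs_le.2 ?_⟩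
    · simp [← h] at h₁
    all_goals simp only [Prod.fst_zero, Prod.snd_zero]; omega
  exact Subtype.ext <| Prod.ext (hf.fst_apply_of_mem_latticeSegment hadj he.1 hX hx hq hfp hfq)
    (hf.snd_apply_of_mem_latticeSegment hadj he.2 hX hx hq hfp hfq)

end Segment

/-! ### Cold sets of slanted rectangles -/

section Frozen

variable {c : ℤ × ℤ} {a b : ℕ}

theorem latticeSegment_subset_slantedRect {p e : ℤ × ℤ} {n : ℕ} (hp : p ∈ slantedRect c a b)
    (hq : p + (n : ℤ) • e ∈ slantedRect c a b) : latticeSegment p e n ⊆ slantedRect c a b := by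
  rintro _ ⟨j, hj, rfl⟩
  have between : ∀ t : ℤ, (0 ≤ j * t ∧ j * t ≤ n * t) ∨ (n * t ≤ j * t ∧ j * t ≤ 0) := fun t => by
    have hjn : (j : ℤ) ≤ n := by exact_mod_cast hj
    rcases le_total 0 t with ht | ht
    · exact Or.inl ⟨by positivity, mul_le_mul_of_nonneg_right hjn ht⟩
    · exact Or.inr ⟨mul_le_mul_of_nonpos_right hjn ht,
        mul_nonpos_of_nonneg_of_nonpos (by positivity) ht⟩
  have hu := between (e.1 + e.2)
  have hv := between (e.1 - e.2)
  simp only [mul_add, mul_sub] at hu hv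
  simp only [slantedRect, Set.mem_ofPred_eq, Prod.fst_add, Prod.snd_add, Prod.smul_fst,
    Prod.smul_snd, smul_eq_mul] at hp hq ⊢
  omega

theorem slantedRect_connected (c : ℤ × ℤ) (a b : ℕ) :
    (c2.induce (slantedRect c a b)).Connected := by
  have hc : c ∈ slantedRect c a b :=
    slantedCorners_subset_slantedRect c a b (by simp [slantedCorners])
  have reachable_corner : ∀ n : ℕ, ∀ x : slantedRect c a b, (x : ℤ × ℤ).1 - c.1 = n →
      (c2.induce (slantedRect c a b)).Reachable ⟨c, hc⟩ x := by
    intro n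
    induction n with
    | zero =>
      rintro ⟨x, hx⟩ hn
      refine reachable_of_eq_or_adj (Or.inl (Subtype.ext (Prod.ext ?_ ?_)))
      all_goals simp only [slantedRect, Set.mem_ofPred_eq] at hx hn ⊢; omega
    | succ n ih =>
      rintro ⟨x, hx⟩ hn
      obtain ⟨y, hy, hy₁, hyx⟩ : ∃ y ∈ slantedRect c a b, y.1 - c.1 = n ∧ c2.Adj y x := by
        have hshift : ∃ δ : ℤ, -1 ≤ δ ∧ δ ≤ 1 ∧ (x.1 - 1, x.2 + δ) ∈ slantedRect c a b := by
          simp only [slantedRect, Set.mem_ofPred_eq] at hx hn ⊢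
          rcases hx.1.1.eq_or_lt with hu | hu
          · exact ⟨1, by omega⟩
          · rcases hx.2.1.eq_or_lt with hv | hv
            · exact ⟨-1, by omega⟩
            · exact ⟨0, by omega⟩
        obtain ⟨δ, h₁, h₂, hmem⟩ := hshift
        refine ⟨_, hmem, by simp only at hn ⊢; omega, fun h => ?_, abs_le.2 ?_, abs_le.2 ?_⟩
        · have := congrArg Prod.fst h
          simp at this
        all_goals simp only; omega
      exact (ih ⟨y, hy⟩ hy₁).trans (SimpleGraph.Adj.reachable (by exact hyx))
  refine (SimpleGraph.connected_iff_exists_forall_reachable _).2 ⟨⟨c, hc⟩, fun x => ?_⟩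
  have hx := x.2
  simp only [slantedRect, Set.mem_ofPred_eq] at hx
  exact reachable_corner ((x : ℤ × ℤ).1 - c.1).toNat x (by omega)

theorem exists_row (x : slantedRect c a b) : ∃ p ∈ slantedBoundary c a b, ∃ n : ℕ,
    p + (n : ℤ) • (1, 0) ∈ slantedBoundary c a b ∧ (x : ℤ × ℤ) ∈ latticeSegment p (1, 0) n := by
  obtain ⟨⟨x, y⟩, hx⟩ := x
  simp only [slantedBoundary, slantedRect, latticeSegment, Set.mem_ofPred_eq, Prod.fst_add,
    Prod.snd_add, Prod.smul_fst, Prod.smul_snd, smul_eq_mul, Prod.ext_iff] at hx ⊢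
  obtain ⟨l, hl⟩ := Int.eq_ofNat_of_zero_le (le_min hx.1.1 hx.2.1)
  obtain ⟨r, hr⟩ := Int.eq_ofNat_of_zero_le
    (le_min (sub_nonneg.2 hx.1.2) (sub_nonneg.2 hx.2.2))
  exact ⟨(x - l, y), by simp only; omega, l + r, by simp only; omega, l, by simp only; omega⟩

theorem exists_column (x : slantedRect c a b) : ∃ p ∈ slantedBoundary c a b, ∃ n : ℕ,
    p + (n : ℤ) • (0, 1) ∈ slantedBoundary c a b ∧ (x : ℤ × ℤ) ∈ latticeSegment p (0, 1) n := by
  obtain ⟨⟨x, y⟩, hx⟩ := x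
  simp only [slantedBoundary, slantedRect, latticeSegment, Set.mem_ofPred_eq, Prod.fst_add,
    Prod.snd_add, Prod.smul_fst, Prod.smul_snd, smul_eq_mul, Prod.ext_iff] at hx ⊢
  obtain ⟨l, hl⟩ := Int.eq_ofNat_of_zero_le (le_min hx.1.1 (sub_nonneg.2 hx.2.2))
  obtain ⟨r, hr⟩ := Int.eq_ofNat_of_zero_le (le_min (sub_nonneg.2 hx.1.2) hx.2.1)
  exact ⟨(x, y - l), by simp only; omega, l + r, by simp only; omega, l, by simp only; omega⟩

variable {f : slantedRect c a b → slantedRect c a b}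

theorem IsContinuous.eq_self_of_mem_slantedBoundary
    (hf : IsContinuous (c2.induce (slantedRect c a b)) f)
    (hfix : ∀ x : slantedRect c a b, (x : ℤ × ℤ) ∈ slantedCorners c a b → f x = x)
    (x : slantedRect c a b) (hx : (x : ℤ × ℤ) ∈ slantedBoundary c a b) : f x = x := by
  rw [← parallelogramVertices_eq_slantedCorners] at hfix
  rw [← parallelogramBoundary_eq_slantedBoundary] at hx
  have hvert : parallelogramVertices c (1, 1) (1, -1) a b ⊆ slantedRect c a b :=
    parallelogramVertices_eq_slantedCorners c a b ▸ slantedCorners_subset_slantedRect c a b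
  have on_side : ∀ p ∈ parallelogramVertices c (1, 1) (1, -1) a b, ∀ e, IsDiagonalStep e →
      ∀ n : ℕ, p + (n : ℤ) • e ∈ parallelogramVertices c (1, 1) (1, -1) a b →
        (x : ℤ × ℤ) ∈ latticeSegment p e n → f x = x := fun p hp e he n hq hx =>
    hf.apply_eq_self_of_isDiagonalStep (p := ⟨p, hvert hp⟩) (q := ⟨_, hvert hq⟩) he
      (latticeSegment_subset_slantedRect (hvert hp) (hvert hq)) hx rfl (hfix _ hp) (hfix _ hq)
  have hup : IsDiagonalStep (1, 1) := by simp [IsDiagonalStep]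
  have hdown : IsDiagonalStep (1, -1) := by simp [IsDiagonalStep]
  rcases hx with ((hx | hx) | hx) | hx
  · exact on_side _ (by simp [parallelogramVertices]) _ hup _ (by simp [parallelogramVertices]) hx
  · exact on_side _ (by simp [parallelogramVertices]) _ hdown _ (by simp [parallelogramVertices]) hx
  · refine on_side _ (by simp [parallelogramVertices]) _ hup _ ?_ hx
    rw [add_right_comm]
    simp [parallelogramVertices]
  · exact on_side _ (by simp [parallelogramVertices]) _ hdown _ (by simp [parallelogramVertices]) hx

theorem IsContinuous.eq_self_of_fixes_corners
    (hf : IsContinuous (c2.induce (slantedRect c a b)) f)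
    (hfix : ∀ x : slantedRect c a b, (x : ℤ × ℤ) ∈ slantedCorners c a b → f x = x)
    (x : slantedRect c a b) : f x = x := by
  have hbd := hf.eq_self_of_mem_slantedBoundary hfix
  refine Subtype.ext (Prod.ext ?_ ?_)
  · obtain ⟨p, hp, n, hq, hx⟩ := exists_row x
    exact hf.fst_apply_of_mem_latticeSegment (p := ⟨p, hp.1⟩) (q := ⟨_, hq.1⟩)
      (by simp [c2, Prod.ext_iff]) (Or.inl rfl) (latticeSegment_subset_slantedRect hp.1 hq.1) hx rfl
      (hbd _ hp) (hbd _ hq)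
  · obtain ⟨p, hp, n, hq, hx⟩ := exists_column x
    exact hf.snd_apply_of_mem_latticeSegment (p := ⟨p, hp.1⟩) (q := ⟨_, hq.1⟩)
      (by simp [c2, Prod.ext_iff]) (Or.inl rfl) (latticeSegment_subset_slantedRect hp.1 hq.1) hx rfl
      (hbd _ hp) (hbd _ hq)

theorem isSColdSet_slantedCorners (c : ℤ × ℤ) (a b : ℕ) :
    IsSColdSet c2 (slantedRect c a b) 0 (slantedCorners c a b) := by
  refine ⟨slantedRect_connected c a b, slantedCorners_subset_slantedRect c a b,
    fun f hf hfix x => ?_⟩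
  rw [hf.eq_self_of_fixes_corners hfix x, SimpleGraph.dist_self]

end Frozen

theorem IsSColdSet.mono {κ : SimpleGraph (ℤ × ℤ)} {X A : Set (ℤ × ℤ)} {s t : ℕ} (hst : s ≤ t)
    (h : IsSColdSet κ X s A) : IsSColdSet κ X t A :=
  ⟨h.1, h.2.1, fun f hf hfix x => (h.2.2 f hf hfix x).trans hst⟩

/-- Otherwise folding `p` onto `q` would be a continuous map that fixes `B` and moves `p` too
far. -/
theorem IsSColdSet.mem_of_fold {κ : SimpleGraph (ℤ × ℤ)} {X B : Set (ℤ × ℤ)} {s : ℕ}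
    (hB : IsSColdSet κ X s B) {p q : X} (hpq : s < (κ.induce X).dist p q)
    (hfold : ∀ r, (κ.induce X).Adj p r → r = q ∨ (κ.induce X).Adj q r) : (p : ℤ × ℤ) ∈ B := by
  classical
  by_contra hp
  have hcont : IsContinuous (κ.induce X) (Function.update id p q) := by
    refine isContinuous_of_eq_or_adj fun x y hxy => ?_
    by_cases hx : x = p
    · subst hx
      rw [Function.update_self, Function.update_of_ne hxy.ne']
      exact (hfold y hxy).imp_left Eq.symm
    · rw [Function.update_of_ne hx]
      by_cases hy : y = p
      · subst hy
        rw [Function.update_self]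
        exact (hfold x hxy.symm).imp_right SimpleGraph.Adj.symm
      · rw [Function.update_of_ne hy]
        exact Or.inr hxy
  have hfix : ∀ x : X, (x : ℤ × ℤ) ∈ B → Function.update id p q x = x := by
    intro x hx
    have hne : x ≠ p := by
      rintro rfl
      exact hp hx
    rw [Function.update_of_ne hne, id]
  have hle := hB.2.2 _ hcont hfix p
  rw [Function.update_self] at hle
  omega

theorem IsColdSet.mem_of_fold {X B : Set (ℤ × ℤ)} (hB : IsColdSet c2 X B) {p q : ℤ × ℤ}
    (hp : p ∈ X) (hq : q ∈ X) (hpq : 2 ≤ |p.1 - q.1| ∨ 2 ≤ |p.2 - q.2|)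
    (hfold : ∀ r ∈ X, c2.Adj p r → |q.1 - r.1| ≤ 1 ∧ |q.2 - r.2| ≤ 1) : p ∈ B := by
  have hne : p ≠ q := by
    rintro rfl
    simp at hpq
  have hnadj : ¬ c2.Adj p q := fun ⟨_, h₁, h₂⟩ => by omega
  refine IsSColdSet.mem_of_fold hB (p := ⟨p, hp⟩) (q := ⟨q, hq⟩) ?_ fun r hr => ?_
  · exact hB.1.one_lt_dist_of_ne_of_not_adj (fun h => hne (congrArg Subtype.val h)) hnadj
  · exact or_iff_not_imp_left.2 fun h =>
      ⟨fun h' => h (Subtype.ext h'.symm), hfold r r.2 hr⟩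

theorem IsColdSet.slantedCorners_subset {c : ℤ × ℤ} {a b : ℕ} (ha : 1 ≤ a) (hb : 1 ≤ b)
    {B : Set (ℤ × ℤ)} (hB : IsColdSet c2 (slantedRect c a b) B) : slantedCorners c a b ⊆ B := by
  intro p hp
  have hpR := slantedCorners_subset_slantedRect c a b hp
  obtain ⟨q, hq, hpq, hfold⟩ : ∃ q ∈ slantedRect c a b, (2 ≤ |p.1 - q.1| ∨ 2 ≤ |p.2 - q.2|) ∧
      ∀ r ∈ slantedRect c a b, c2.Adj p r → |q.1 - r.1| ≤ 1 ∧ |q.2 - r.2| ≤ 1 := by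
    simp only [slantedCorners, slantedRect, c2, Set.mem_ofPred_eq, abs_le, le_abs, ne_eq,
      Prod.ext_iff] at hp ⊢
    obtain ⟨hu | hu, hv | hv⟩ := hp
    · refine ⟨(p.1 + 2, p.2), ?_, ?_, fun r hr h => ?_⟩ <;> simp only <;> omega
    · refine ⟨(p.1, p.2 + 2), ?_, ?_, fun r hr h => ?_⟩ <;> simp only <;> omega
    · refine ⟨(p.1, p.2 - 2), ?_, ?_, fun r hr h => ?_⟩ <;> simp only <;> omega
    · refine ⟨(p.1 - 2, p.2), ?_, ?_, fun r hr h => ?_⟩ <;> simp only <;> omega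
  exact hB.mem_of_fold hpR hq hpq hfold

end DigitalPlane

open DigitalPlane

theorem proposition7p1_general (S : ClosedCurve) (hfour : S.sides.ncard = 4)
    (hslanted : ∀ σ ∈ S.sides, IsSlanted σ) :
    IsSColdSet c2 (S.carrier ∪ S.interior) 0 S.sideEndpoints ∧
      ∀ B, IsColdSet c2 (S.carrier ∪ S.interior) B → S.sideEndpoints ⊆ B := by
  obtain ⟨c, a, b, ha, hb, hcarrier, hends⟩ := S.exists_slantedRect hfour hslanted
  rw [S.carrier_union_interior hcarrier, hends]
  exact ⟨isSColdSet_slantedCorners c a b, fun B hB => hB.slantedCorners_subset ha hb⟩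

theorem proposition7p1 (X : Set (ℤ × ℤ)) (hX : DigitalPlane.IsThickDisk X)
    (S : DigitalPlane.ClosedCurve) (hS : S.Bounds X)
    (hfour : S.sides.ncard = 4) (hslanted : ∀ σ ∈ S.sides, DigitalPlane.IsSlanted σ) :
    DigitalPlane.IsMinimalColdSet DigitalPlane.c2 X S.sideEndpoints := by
  obtain ⟨hfreezing, hleast⟩ := hS.2 ▸ proposition7p1_general S hfour hslanted
  exact ⟨hfreezing.mono zero_le_one, fun B hB hcold => hB.2 (hleast B hcold)⟩
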